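/- Let $\mathbb{T}\subseteq\mathbb{R}$ be a time scale (a nonempty closed set), let $a<b$ be points of $\mathbb{T}$, and regard $[a,b]:=\{t\in\mathbb{T}: a\le t\le b\}$ as a time scale in its own right, with forward and backward jump operators $\sigma,\rho$ (so $\rho(a)=a$ and $\sigma(b)=b$). Let $[a,b]_\kappa=[a,b]\setminus\{a\}$ if $\sigma(a)>a$, and $[a,b]_\kappa=[a,b]$ otherwise. Write $x^\rho=x\circ\rho$; let $x^\nabla$ be the nabla derivative (defined on $[a,b]_\kappa$), and let $\int\cdot\,\nabla t$ be the nabla integral ($\int_c^d g\,\nabla t=G(d)-G(c)$ with $G^\nabla=g$ on $[a,b]_\kappa$). A function is ld-continuous if it is continuous at left-dense points and has finite right-sided limits at right-dense points. Let $C^1_{ld}$ be the set of nabla differentiable functions $x:[a,b]\to\mathbb{R}$ with ld-continuous $x^\nabla$, with the norm $\|x\|_1=\sup_{t\in[a,b]}|x^\rho(t)|+\sup_{t\in[a,b]_\kappa}|x^\nabla(t)|$. Let $H:\mathbb{R}^n\to\mathbb{R}$ have continuous partial derivatives $H'_1,\dots,H'_n$. For $i=1,\dots,n$ let $f_i:[a,b]\times\mathbb{R}^2\to\mathbb{R}$,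 $(t,y,v)\mapsto f_i(t,y,v)$, have partial derivatives $f_{iy},f_{iv}$ with respect to $y$ and $v$ that are continuous in $(y,v)$ for every $t$ and bounded on $[a,b]\times K$ for every bounded $K\subset\mathbb{R}^2$, and suppose that for all $x\in C^1_{ld}$ the functions $t\mapsto g(t,x^\rho(t),x^\nabla(t))$, $g\in\{f_i,f_{iy},f_{iv}\}$, are ld-continuous on $[a,b]_\kappa$. Put $$\mathcal{F}_i[x]=\int_a^b f_i(t,x^\rho(t),x^\nabla(t))\,\nabla t,\qquad \mathcal{L}[x]=H(\mathcal{F}_1[x],\dots,\mathcal{F}_n[x]).$$ Call $x\in C^1_{ld}$ admissible if it satisfies those of the end-point conditions $x(a)=x_a$, $x(b)=x_b$ that are imposed (none, one or both of them may be imposed). Let $\tilde x$ be a weak local extremizer of $\mathcal{L}$: $\tilde x$ is admissible, and for some $\delta>0$ either $\mathcal{L}[\tilde x]\le\mathcal{L}[x]$ for all admissible $x$ with $\|x-\tilde x\|_1<\delta$, or $\mathcal{L}[\tilde x]\ge\mathcal{L}[x]$ for all such $x$. Abbreviate $H'_i=H'_i(\mathcal{F}_1[\tilde x],\dots,\mathcal{F}_n[\tilde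 x])$ and $g[\tilde x](t)=g(t,\tilde x^\rho(t),\tilde x^\nabla(t))$. Then: 1. (Euler–Lagrange equation) For every $t\in[a,b]_\kappa$ with $\rho(t)\in[a,b]_\kappa$ (that is, every $t\in[a,b]_\kappa$ except $t=\sigma(a)$ when $\sigma(a)>a$), the function $\sum_{i=1}^n H'_i\,f_{iv}[\tilde x]$ is nabla differentiable at $t$, and $$\Big(\sum_{i=1}^n H'_i\,f_{iv}[\tilde x]\Big)^{\nabla}(t)=\sum_{i=1}^n H'_i\,f_{iy}[\tilde x](t).$$ In particular, whenever every $f_{iv}[\tilde x]$ is nabla differentiable at such a $t$, $$\sum_{i=1}^n H'_i\,\big((f_{iv}[\tilde x])^\nabla(t)-f_{iy}[\tilde x](t)\big)=0.$$ 2. If $x(a)$ is not specified, then $$\sum_{i=1}^n H'_i\Big(\int_a^{\sigma(a)} f_{iy}[\tilde x](t)\,\nabla t-f_{iv}[\tilde x](\sigma(a))\Big)=0.$$ 3. If $x(b)$ is not specified, then $\sum_{i=1}^n H'_i\,f_{iv}[\tilde x](b)=0$. -/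

import Mathlib

open Set Filter Topology

noncomputable section

namespace NablaCalculus

/-- The interval `[a,b]` of the time scale `T`; it is a time scale in its own right. -/
def interval (T : Set ℝ) (a b : ℝ) : Set ℝ := T ∩ Icc a b

open Classical in
/-- The backward jump operator of the time scale `T`: `sup {s ∈ T : s < t}`, and `t` itself if
`t` is the minimum of `T`. -/
def rho (T : Set ℝ) (t : ℝ) : ℝ := if (T ∩ Iio t).Nonempty then sSup (T ∩ Iio t) else t

open Classical in
/-- The forward jump operator of the time scale `T`: `inf {s ∈ T : s > t}`, and `t` itself if
`t` is the maximum of `T`. -/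
def sigma (T : Set ℝ) (t : ℝ) : ℝ := if (T ∩ Ioi t).Nonempty then sInf (T ∩ Ioi t) else t

/-- `T_κ`: the set `T` without its minimum if that minimum exists and is right-scattered. -/
def kappa (T : Set ℝ) : Set ℝ := {t ∈ T | ¬ (IsLeast T t ∧ t < sigma T t)}

/-- The real number `d` is a nabla derivative of `g : T → ℝ` at `t`
(only the values of `g` on `T` matter). -/
def HasNablaDerivAt (T : Set ℝ) (g : ℝ → ℝ) (d t : ℝ) : Prop :=
  ∀ ε > 0, ∃ U ∈ 𝓝 t, ∀ s ∈ U ∩ T,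
    |g (rho T t) - g s - d * (rho T t - s)| ≤ ε * |rho T t - s|

open Classical in
/-- The nabla derivative `g^∇(t)`; it is unique for `t ∈ T_κ`, and it is only used there. -/
def nablaDeriv (T : Set ℝ) (g : ℝ → ℝ) (t : ℝ) : ℝ :=
  if h : ∃ d, HasNablaDerivAt T g d t then h.choose else 0

/-- `g` is nabla differentiable: its nabla derivative exists at every point of `T_κ`. -/
def NablaDifferentiable (T : Set ℝ) (g : ℝ → ℝ) : Prop :=
  ∀ t ∈ kappa T, ∃ d, HasNablaDerivAt T g d t

/-- ld-continuity on `D ⊆ T` with respect to the time scale `T` (here `D` is `T` or `T_κ`):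
continuity at the left-dense points and finite right-sided limits at the right-dense points. -/
def LdContinuousOn (T D : Set ℝ) (g : ℝ → ℝ) : Prop :=
  ∀ t ∈ D, (rho T t = t → ContinuousWithinAt g D t) ∧
    (sigma T t = t → ∃ l : ℝ, Tendsto g (𝓝[D ∩ Ioi t] t) (𝓝 l))

/-- The class `C¹_ld(T)`. -/
def C1ld (T : Set ℝ) (x : ℝ → ℝ) : Prop :=
  NablaDifferentiable T x ∧ LdContinuousOn T (kappa T) (nablaDeriv T x)

/-- `F` is a nabla antiderivative of `g` on the time scale `T`. -/
def IsNablaAntideriv (T : Set ℝ) (F g : ℝ → ℝ) : Prop :=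
  ∀ t ∈ kappa T, HasNablaDerivAt T F (g t) t

open Classical in
/-- The nabla integral `∫_c^d g(t) ∇t = F(d) - F(c)`, where `F` is a nabla antiderivative of `g`
(one exists when `g` is ld-continuous, and it is unique up to a constant). -/
def nablaIntegral (T : Set ℝ) (g : ℝ → ℝ) (c d : ℝ) : ℝ :=
  if h : ∃ F, IsNablaAntideriv T F g then h.choose d - h.choose c else 0

/-- The function `t ↦ g(t, x^ρ(t), x^∇(t))`. -/
def along (T : Set ℝ) (g : ℝ → ℝ → ℝ → ℝ) (x : ℝ → ℝ) (t : ℝ) : ℝ :=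
  g t (x (rho T t)) (nablaDeriv T x t)

/-- The partial derivative of `f(t,y,v)` with respect to `y`. -/
def partialY (f : ℝ → ℝ → ℝ → ℝ) (t y v : ℝ) : ℝ := deriv (fun y' => f t y' v) y

/-- The partial derivative of `f(t,y,v)` with respect to `v`. -/
def partialV (f : ℝ → ℝ → ℝ → ℝ) (t y v : ℝ) : ℝ := deriv (fun v' => f t y v') v

/-- The assumptions on a Lagrangian `f(t,y,v)`, `t ∈ T`. -/
structure IsLagrangian (T : Set ℝ) (f : ℝ → ℝ → ℝ → ℝ) : Prop where
  differentiable_y : ∀ t ∈ T, ∀ y v, DifferentiableAt ℝ (fun y' => f t y' v) y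
  differentiable_v : ∀ t ∈ T, ∀ y v, DifferentiableAt ℝ (fun v' => f t y v') v
  continuous_y : ∀ t ∈ T, Continuous (fun p : ℝ × ℝ => partialY f t p.1 p.2)
  continuous_v : ∀ t ∈ T, Continuous (fun p : ℝ × ℝ => partialV f t p.1 p.2)
  /-- The partial derivatives are bounded for bounded `(y,v)`, uniformly in `t`
  (automatic when they are jointly continuous and `T` is compact). -/
  bounded : ∀ R : ℝ, ∃ M : ℝ, ∀ t ∈ T, ∀ y v : ℝ, |y| ≤ R → |v| ≤ R →
    |partialY f t y v| ≤ M ∧ |partialV f t y v| ≤ M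
  ld : ∀ x, C1ld T x → LdContinuousOn T (kappa T) (along T f x)
  ld_y : ∀ x, C1ld T x → LdContinuousOn T (kappa T) (along T (partialY f) x)
  ld_v : ∀ x, C1ld T x → LdContinuousOn T (kappa T) (along T (partialV f) x)

/-- The partial derivative `H'_i` of `H` at `z`. -/
def partialH {n : ℕ} (H : (Fin n → ℝ) → ℝ) (i : Fin n) (z : Fin n → ℝ) : ℝ :=
  lineDeriv ℝ H z (Pi.single i 1)

/-- `H` has continuous partial derivatives. -/
def HasContinuousPartials {n : ℕ} (H : (Fin n → ℝ) → ℝ) : Prop :=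
  ∀ i, (∀ z, LineDifferentiableAt ℝ H z (Pi.single i 1)) ∧ Continuous (partialH H i)

/-- The vector of the integrals `F_i[x] = ∫_a^b f_i(t, x^ρ(t), x^∇(t)) ∇t`. -/
def integrals {n : ℕ} (T : Set ℝ) (a b : ℝ) (f : Fin n → ℝ → ℝ → ℝ → ℝ) (x : ℝ → ℝ) :
    Fin n → ℝ :=
  fun i => nablaIntegral T (along T (f i) x) a b

/-- The functional `L[x] = H(F_1[x], …, F_n[x])`. -/
def functional {n : ℕ} (T : Set ℝ) (a b : ℝ) (H : (Fin n → ℝ) → ℝ)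
    (f : Fin n → ℝ → ℝ → ℝ → ℝ) (x : ℝ → ℝ) : ℝ :=
  H (integrals T a b f x)

/-- The norm of `C¹_ld(T)`: the sum of the suprema of `|x^ρ|` and of `|x^∇|`. -/
def normOne (T : Set ℝ) (x : ℝ → ℝ) : ℝ :=
  sSup ((fun t => |x (rho T t)|) '' T) + sSup ((fun t => |nablaDeriv T x t|) '' kappa T)

/-- Admissible functions; `none` means that the value at that end-point is not specified. -/
def Admissible (T : Set ℝ) (a b : ℝ) (xa xb : Option ℝ) (x : ℝ → ℝ) : Prop :=
  C1ld T x ∧ (∀ c, xa = some c → x a = c) ∧ (∀ c, xb = some c → x b = c)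

/-- `x` is a weak local minimizer of `L` among the admissible functions. -/
def IsWeakLocalMin (T : Set ℝ) (a b : ℝ) (xa xb : Option ℝ) (L : (ℝ → ℝ) → ℝ) (x : ℝ → ℝ) :
    Prop :=
  Admissible T a b xa xb x ∧
    ∃ δ > 0, ∀ z, Admissible T a b xa xb z → normOne T (fun t => z t - x t) < δ → L x ≤ L z

/-- `x` is a weak local maximizer of `L` among the admissible functions. -/
def IsWeakLocalMax (T : Set ℝ) (a b : ℝ) (xa xb : Option ℝ) (L : (ℝ → ℝ) → ℝ) (x : ℝ → ℝ) :
    Prop :=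
  Admissible T a b xa xb x ∧
    ∃ δ > 0, ∀ z, Admissible T a b xa xb z → normOne T (fun t => z t - x t) < δ → L z ≤ L x

end NablaCalculus

end

open NablaCalculus

/-!
Write `p = ∑ H'_i f_{iv}[x]`, `q = ∑ H'_i f_{iy}[x]` for the extremizer `x`, and let `Q` be the nabla
antiderivative of `q` vanishing at `a`. For a variation `η ∈ C¹_ld` that keeps `x + ε η` admissible,
`ε ↦ L[x + ε η]` has a local extremum at `0`, so that `∫_a^b (q η^ρ + p η^∇) ∇t = 0`
(`firstVariation_eq_zero`). Integrating `q η^ρ` by parts turns this into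
`∫_a^b (p - Q - c) η^∇ ∇t = 0` for all constants `c` and all `η` vanishing at `a` and `b`; the choice
`η^∇ = p - Q - c`, with `c` the mean value of `p - Q`, shows `p = Q + c` on `T_κ`
(`exists_eq_add_const`). This identity gives the differentiability of `p` and the Euler–Lagrange
equation at once. Reinserting it, the first variation becomes `(Q(b) + c) η(b) - (Q(a) + c) η(a)`,
and `η = t - a`, `η = t - b` give the natural boundary conditions.

The analytic facts needed for this are the following.

* The nabla integral is well defined: antiderivatives are unique up to a constant, because a function
  with nonnegative nabla derivative is monotone (`IsNablaAntideriv.le`), and they exist for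
  ld-continuous `g`, namely as the Lebesgue integral of the extension of `g` that is constant on the
  gaps of the time scale (`LdContinuousOn.isNablaAntideriv`). The extension is measurable since
  an ld-continuous function is discontinuous at left-scattered points only, which are countable.
* One may differentiate under the integral sign (`IsLagrangian.hasDerivAt_nablaIntegral`). As the
  partial derivatives are only bounded, and not assumed equicontinuous in `t`, this uses dominated
  convergence in the Lebesgue representation.
* Continuous partial derivatives imply Fréchet differentiability, for `H` and for each `f_i(t, ·, ·)`,
  which yields the chain rule.
-/

namespace NablaCalculus

/-! ### Compact time scales and their jump operators -/

/-- `T` is a compact time scale with minimum `a` and maximum `b`, where `a < b`. -/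
structure IsCompactScale (T : Set ℝ) (a b : ℝ) : Prop where
  isClosed : IsClosed T
  left_mem : a ∈ T
  right_mem : b ∈ T
  subset_Icc : T ⊆ Icc a b
  lt : a < b

theorem isCompactScale_interval {T : Set ℝ} (hT : IsClosed T) {a b : ℝ} (ha : a ∈ T) (hb : b ∈ T)
    (hab : a < b) : IsCompactScale (interval T a b) a b where
  isClosed := hT.inter isClosed_Icc
  left_mem := ⟨ha, le_rfl, hab.le⟩
  right_mem := ⟨hb, hab.le, le_rfl⟩
  subset_Icc := inter_subset_right
  lt := hab

section Jump

variable {T : Set ℝ} {s t : ℝ}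

theorem rho_le (T : Set ℝ) (t : ℝ) : rho T t ≤ t := by
  unfold rho
  split_ifs with h
  · exact csSup_le h fun s hs => hs.2.le
  · exact le_rfl

theorem le_rho (hs : s ∈ T) (hst : s < t) : s ≤ rho T t := by
  have h : (T ∩ Iio t).Nonempty := ⟨s, hs, hst⟩
  rw [rho, if_pos h]
  exact le_csSup ⟨t, fun r hr => hr.2.le⟩ ⟨hs, hst⟩

theorem le_sigma (T : Set ℝ) (t : ℝ) : t ≤ sigma T t := by
  unfold sigma
  split_ifs with h
  · exact le_csInf h fun s hs => hs.2.le
  · exact le_rfl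

theorem sigma_le (hs : s ∈ T) (hst : t < s) : sigma T t ≤ s := by
  have h : (T ∩ Ioi t).Nonempty := ⟨s, hs, hst⟩
  rw [sigma, if_pos h]
  exact csInf_le ⟨t, fun r hr => hr.2.le⟩ ⟨hs, hst⟩

theorem rho_mem (hT : IsClosed T) (ht : t ∈ T) : rho T t ∈ T := by
  unfold rho
  split_ifs with h
  · exact closure_minimal inter_subset_left hT (csSup_mem_closure h ⟨t, fun r hr => hr.2.le⟩)
  · exact ht

theorem sigma_mem (hT : IsClosed T) (ht : t ∈ T) : sigma T t ∈ T := by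
  unfold sigma
  split_ifs with h
  · exact closure_minimal inter_subset_left hT (csInf_mem_closure h ⟨t, fun r hr => hr.2.le⟩)
  · exact ht

theorem exists_mem_Ioo_of_rho_eq (hρ : rho T t = t) (hs : s ∈ T) (hst : s < t) {c : ℝ}
    (hc : c < t) : ∃ r ∈ T, c < r ∧ r < t := by
  have h : (T ∩ Iio t).Nonempty := ⟨s, hs, hst⟩
  rw [rho, if_pos h] at hρ
  obtain ⟨r, hr, hcr⟩ := exists_lt_of_lt_csSup h (hρ.symm ▸ hc)
  exact ⟨r, hr.1, hcr, hr.2⟩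

theorem exists_mem_Ioo_of_sigma_eq (hσ : sigma T t = t) (hs : s ∈ T) (hst : t < s) {c : ℝ}
    (hc : t < c) : ∃ r ∈ T, t < r ∧ r < c := by
  have h : (T ∩ Ioi t).Nonempty := ⟨s, hs, hst⟩
  rw [sigma, if_pos h] at hσ
  obtain ⟨r, hr, hcr⟩ := exists_lt_of_csInf_lt h (hσ.symm ▸ hc)
  exact ⟨r, hr.1, hr.2, hcr⟩

/-- The backward jump operator is continuous at left-dense points. -/
theorem tendsto_rho (hρ : rho T t = t) : Tendsto (rho T) (𝓝[T] t) (𝓝 t) := by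
  refine tendsto_order.2 ⟨fun c hc => ?_, fun c hc => ?_⟩
  · by_cases h : ∃ s ∈ T, s < t
    · obtain ⟨s, hs, hst⟩ := h
      obtain ⟨r, hr, hcr, hrt⟩ := exists_mem_Ioo_of_rho_eq hρ hs hst hc
      filter_upwards [mem_nhdsWithin_of_mem_nhds (Ioi_mem_nhds hrt)] with u hu
      exact hcr.trans_le (le_rho hr hu)
    · push Not at h
      filter_upwards [self_mem_nhdsWithin] with u hu
      rcases (h u hu).eq_or_lt with rfl | htu
      · rwa [hρ]
      · by_cases ht : t ∈ T
        · exact hc.trans_le (le_rho ht htu)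
        · refine hc.trans_le ?_
          unfold rho
          split_ifs with h'
          · obtain ⟨v, hv⟩ := h'
            exact (h v hv.1).trans (le_csSup ⟨u, fun r hr => hr.2.le⟩ hv)
          · exact htu.le
  · filter_upwards [mem_nhdsWithin_of_mem_nhds (Iio_mem_nhds hc)] with u hu
    exact (rho_le T u).trans_lt hu

theorem tendsto_rho_right (ht : t ∈ T) : Tendsto (rho T) (𝓝[T ∩ Ioi t] t) (𝓝 t) := by
  refine tendsto_of_tendsto_of_tendsto_of_le_of_le' tendsto_const_nhds
    (tendsto_id.mono_left nhdsWithin_le_nhds) ?_ (Eventually.of_forall (rho_le T))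
  filter_upwards [self_mem_nhdsWithin] with u hu
  exact le_rho ht hu.2

theorem kappa_subset (T : Set ℝ) : kappa T ⊆ T := fun _ ht => ht.1

end Jump

namespace IsCompactScale

variable {T : Set ℝ} {a b t : ℝ}

theorem isCompact (h : IsCompactScale T a b) : IsCompact T :=
  isCompact_Icc.of_isClosed_subset h.isClosed h.subset_Icc

theorem isLeast (h : IsCompactScale T a b) : IsLeast T a :=
  ⟨h.left_mem, fun _ ht => (h.subset_Icc ht).1⟩

theorem mem_kappa_of_lt (h : IsCompactScale T a b) (ht : t ∈ T) (hat : a < t) : t ∈ kappa T :=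
  ⟨ht, fun h' => hat.not_ge (h'.1.2 h.left_mem)⟩

theorem right_mem_kappa (h : IsCompactScale T a b) : b ∈ kappa T :=
  h.mem_kappa_of_lt h.right_mem h.lt

theorem left_mem_kappa_iff (h : IsCompactScale T a b) : a ∈ kappa T ↔ sigma T a = a := by
  constructor
  · intro h'
    by_contra hne
    exact h'.2 ⟨h.isLeast, (le_sigma T a).lt_of_ne' hne⟩
  · intro h'
    exact ⟨h.left_mem, fun h'' => h''.2.ne' h'⟩

theorem sigma_left_mem_kappa (h : IsCompactScale T a b) : sigma T a ∈ kappa T := by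
  by_cases hσ : sigma T a = a
  · rw [hσ]
    exact h.left_mem_kappa_iff.2 hσ
  · exact h.mem_kappa_of_lt (sigma_mem h.isClosed h.left_mem) ((le_sigma T a).lt_of_ne' hσ)

/-- A point outside `T_κ` can only be the right-scattered minimum, so it is isolated. -/
theorem eq_of_not_mem_kappa (h : IsCompactScale T a b) (ht : t ∈ T) (ht' : t ∉ kappa T) :
    t = a ∧ 𝓝[T] t = pure t := by
  have hta : t = a := by
    by_contra hne
    exact ht' (h.mem_kappa_of_lt ht ((h.subset_Icc ht).1.lt_of_ne' hne))
  subst hta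
  refine ⟨rfl, ?_⟩
  have hσ : t < sigma T t := by
    by_contra hle
    exact ht' (h.left_mem_kappa_iff.2 (le_antisymm (not_lt.1 hle) (le_sigma T t)))
  refine le_antisymm (fun s hs => ?_) (pure_le_nhdsWithin ht)
  filter_upwards [self_mem_nhdsWithin, mem_nhdsWithin_of_mem_nhds (Iio_mem_nhds hσ)] with u hu hu'
  rcases (h.isLeast.2 hu).eq_or_lt with rfl | hlt
  · exact hs
  · exact absurd (sigma_le hu hlt) (not_le.2 hu')

theorem kappa_mem_nhdsWithin (h : IsCompactScale T a b) (ht : t ∈ kappa T) :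
    kappa T ∈ 𝓝[T] t := by
  by_cases ha : a ∈ kappa T
  · filter_upwards [self_mem_nhdsWithin] with u hu
    by_contra hu'
    exact hu' ((h.eq_of_not_mem_kappa hu hu').1 ▸ ha)
  · have hta : t ≠ a := fun e => ha (e ▸ ht)
    filter_upwards [self_mem_nhdsWithin, mem_nhdsWithin_of_mem_nhds (isOpen_ne.mem_nhds hta)]
      with u hu hu'
    exact h.mem_kappa_of_lt hu ((h.isLeast.2 hu).lt_of_ne' hu')

theorem isClosed_kappa (h : IsCompactScale T a b) : IsClosed (kappa T) := by
  refine isClosed_of_closure_subset fun t ht => ?_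
  have htT : t ∈ T := closure_minimal (kappa_subset T) h.isClosed ht
  by_contra ht'
  have hp := (h.eq_of_not_mem_kappa htT ht').2
  rw [mem_closure_iff_nhdsWithin_neBot] at ht
  have hle : 𝓝[kappa T] t ≤ pure t := hp ▸ nhdsWithin_mono _ (kappa_subset T)
  have : ({t} : Set ℝ) ∩ kappa T ∈ 𝓝[kappa T] t := inter_mem (hle rfl) self_mem_nhdsWithin
  obtain ⟨u, hu, hu'⟩ := ht.nonempty_of_mem this
  exact ht' (mem_singleton_iff.1 hu ▸ hu')

theorem isCompact_kappa (h : IsCompactScale T a b) : IsCompact (kappa T) :=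
  h.isCompact.of_isClosed_subset h.isClosed_kappa (kappa_subset T)

theorem uniqueDiffWithinAt (h : IsCompactScale T a b) (ht : t ∈ kappa T) (hρ : rho T t = t) :
    UniqueDiffWithinAt ℝ T t := by
  rw [uniqueDiffWithinAt_iff_accPt, accPt_iff_frequently, frequently_iff]
  intro U hU
  obtain ⟨ε, hε, hεU⟩ := Metric.mem_nhds_iff.1 hU
  rcases (h.isLeast.2 ht.1).eq_or_lt with rfl | hat
  · obtain ⟨r, hr, h1, h2⟩ := exists_mem_Ioo_of_sigma_eq (h.left_mem_kappa_iff.1 ht) h.right_mem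
      h.lt (show a < a + ε by linarith)
    exact ⟨r, hεU (by rw [Metric.mem_ball, Real.dist_eq, abs_of_pos] <;> linarith), h1.ne', hr⟩
  · obtain ⟨r, hr, h1, h2⟩ := exists_mem_Ioo_of_rho_eq hρ h.left_mem hat
      (show t - ε < t by linarith)
    exact ⟨r, hεU (by rw [Metric.mem_ball, Real.dist_eq, abs_of_neg] <;> linarith), h2.ne, hr⟩

end IsCompactScale

/-! ### Nabla derivatives -/

section Deriv

variable {T : Set ℝ} {f g : ℝ → ℝ} {c d t : ℝ}

theorem hasNablaDerivAt_iff_eventually : HasNablaDerivAt T g d t ↔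
    ∀ ε > 0, ∀ᶠ s in 𝓝[T] t, |g (rho T t) - g s - d * (rho T t - s)| ≤ ε * |rho T t - s| := by
  refine forall₂_congr fun ε _ => ?_
  rw [eventually_iff, mem_nhdsWithin_iff_exists_mem_nhds_inter]
  rfl

/-- At a left-dense point the nabla derivative is the derivative within the time scale. -/
theorem hasNablaDerivAt_iff_of_eq (hρ : rho T t = t) :
    HasNablaDerivAt T g d t ↔ HasDerivWithinAt g d T t := by
  rw [hasNablaDerivAt_iff_eventually, hρ, hasDerivWithinAt_iff_isLittleO, Asymptotics.isLittleO_iff]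
  refine forall₂_congr fun ε _ => eventually_congr (Eventually.of_forall fun s => ?_)
  rw [Real.norm_eq_abs, Real.norm_eq_abs, abs_sub_comm s t, ← abs_neg (g t - g s - d * (t - s)),
    smul_eq_mul]
  ring_nf

/-- At a left-scattered point the nabla derivative is a difference quotient, and its existence
amounts to continuity. -/
theorem hasNablaDerivAt_iff_of_lt (ht : t ∈ T) (hρ : rho T t < t) :
    HasNablaDerivAt T g d t ↔
      ContinuousWithinAt g T t ∧ g t - g (rho T t) = d * (t - rho T t) := by
  rw [hasNablaDerivAt_iff_eventually]
  set r := rho T t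
  constructor
  · intro h
    have heq : g t - g r = d * (t - r) := by
      have h0 : |g r - g t - d * (r - t)| ≤ 0 := by
        refine le_of_forall_pos_le_add fun ε hε => ?_
        have hpos : 0 < |r - t| := abs_pos.2 (sub_ne_zero.2 hρ.ne)
        have := (h (ε / |r - t|) (by positivity)).self_of_nhdsWithin ht
        rwa [div_mul_cancel₀ _ hpos.ne', ← zero_add ε] at this
      have := abs_eq_zero.1 (le_antisymm h0 (abs_nonneg _))
      linarith
    refine ⟨?_, heq⟩
    have hlim : Tendsto (fun s => g r - g s - d * (r - s)) (𝓝[T] t) (𝓝 0) := by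
      have hb : ∀ᶠ s in 𝓝[T] t, |r - s| ≤ |r - t| + 1 := by
        have : ContinuousAt (fun s => |r - s|) t := by fun_prop
        filter_upwards [mem_nhdsWithin_of_mem_nhds
          (this.eventually_lt continuousAt_const (lt_add_one |r - t|))] with s hs using le_of_lt hs
      rw [Metric.tendsto_nhds]
      intro ε hε
      have hpos : 0 < |r - t| + 1 := by positivity
      filter_upwards [hb, h (ε / 2 / (|r - t| + 1)) (by positivity)] with s hs hs'
      rw [Real.dist_eq, sub_zero]
      calc _ ≤ _ := hs'
        _ ≤ ε / 2 / (|r - t| + 1) * (|r - t| + 1) := by gcongr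
        _ = ε / 2 := div_mul_cancel₀ _ hpos.ne'
        _ < ε := by linarith
    have hlin : Tendsto (fun s => g r - d * (r - s)) (𝓝[T] t) (𝓝 (g r - d * (r - t))) :=
      (show Continuous fun s => g r - d * (r - s) by fun_prop).continuousWithinAt
    have := hlin.sub hlim
    refine (this.congr fun s => by ring).trans ?_
    rw [show g r - d * (r - t) - 0 = g t by linarith]
  · rintro ⟨hc, heq⟩ ε hε
    have hlim : Tendsto (fun s => |g r - g s - d * (r - s)| - ε * |r - s|) (𝓝[T] t)
        (𝓝 (|g r - g t - d * (r - t)| - ε * |r - t|)) := by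
      have hid : ContinuousWithinAt (fun s : ℝ => s) T t := continuousWithinAt_id
      refine ContinuousWithinAt.tendsto (f := fun s => |g r - g s - d * (r - s)| - ε * |r - s|) ?_
      exact (((continuousWithinAt_const.sub hc).sub
        (continuousWithinAt_const.mul (continuousWithinAt_const.sub hid))).abs).sub
        (continuousWithinAt_const.mul (continuousWithinAt_const.sub hid).abs)
    have hneg : |g r - g t - d * (r - t)| - ε * |r - t| < 0 := by
      rw [show g r - g t - d * (r - t) = 0 by linarith, abs_zero, zero_sub, neg_lt_zero]
      exact mul_pos hε (abs_pos.2 (sub_ne_zero.2 hρ.ne))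
    filter_upwards [hlim.eventually_lt_const hneg] with s hs
    linarith

/-- The two descriptions of the nabla derivative, at left-dense and at left-scattered points. -/
theorem hasNablaDerivAt_cases (ht : t ∈ T)
    (h₁ : rho T t = t → HasDerivWithinAt g d T t)
    (h₂ : rho T t < t → ContinuousWithinAt g T t ∧ g t - g (rho T t) = d * (t - rho T t)) :
    HasNablaDerivAt T g d t := by
  rcases (rho_le T t).eq_or_lt with hρ | hρ
  · exact (hasNablaDerivAt_iff_of_eq hρ).2 (h₁ hρ)
  · exact (hasNablaDerivAt_iff_of_lt ht hρ).2 (h₂ hρ)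

theorem HasNablaDerivAt.continuousWithinAt (h : HasNablaDerivAt T g d t) (ht : t ∈ T) :
    ContinuousWithinAt g T t := by
  rcases (rho_le T t).eq_or_lt with hρ | hρ
  · exact ((hasNablaDerivAt_iff_of_eq hρ).1 h).continuousWithinAt
  · exact ((hasNablaDerivAt_iff_of_lt ht hρ).1 h).1

theorem HasNablaDerivAt.add (hf : HasNablaDerivAt T f c t) (hg : HasNablaDerivAt T g d t)
    (ht : t ∈ T) : HasNablaDerivAt T (fun s => f s + g s) (c + d) t := by
  refine hasNablaDerivAt_cases ht (fun hρ => ?_) (fun hρ => ?_)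
  · exact ((hasNablaDerivAt_iff_of_eq hρ).1 hf).add ((hasNablaDerivAt_iff_of_eq hρ).1 hg)
  · have h1 := (hasNablaDerivAt_iff_of_lt ht hρ).1 hf
    have h2 := (hasNablaDerivAt_iff_of_lt ht hρ).1 hg
    exact ⟨h1.1.add h2.1, by linear_combination h1.2 + h2.2⟩

/-- The product rule `(fg)^∇ = f^∇ g^ρ + f g^∇`. -/
theorem HasNablaDerivAt.mul (hf : HasNablaDerivAt T f c t) (hg : HasNablaDerivAt T g d t)
    (ht : t ∈ T) :
    HasNablaDerivAt T (fun s => f s * g s) (c * g (rho T t) + f t * d) t := by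
  refine hasNablaDerivAt_cases ht (fun hρ => ?_) (fun hρ => ?_)
  · rw [hρ]
    exact ((hasNablaDerivAt_iff_of_eq hρ).1 hf).mul ((hasNablaDerivAt_iff_of_eq hρ).1 hg)
  · have h1 := (hasNablaDerivAt_iff_of_lt ht hρ).1 hf
    have h2 := (hasNablaDerivAt_iff_of_lt ht hρ).1 hg
    exact ⟨h1.1.mul h2.1, by linear_combination g (rho T t) * h1.2 + f t * h2.2⟩

theorem hasNablaDerivAt_const (T : Set ℝ) (c t : ℝ) : HasNablaDerivAt T (fun _ => c) 0 t :=
  fun ε hε => ⟨univ, univ_mem, fun s _ => by simpa using by positivity⟩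

theorem hasNablaDerivAt_id (T : Set ℝ) (t : ℝ) : HasNablaDerivAt T (fun s => s) 1 t :=
  fun ε hε => ⟨univ, univ_mem, fun s _ => by simpa using by positivity⟩

theorem HasNablaDerivAt.const_mul (c : ℝ) (hg : HasNablaDerivAt T g d t) (ht : t ∈ T) :
    HasNablaDerivAt T (fun s => c * g s) (c * d) t := by
  simpa using (hasNablaDerivAt_const T c t).mul hg ht

theorem HasNablaDerivAt.sum {ι : Type*} {u : Finset ι} {f : ι → ℝ → ℝ} {d : ι → ℝ}
    (h : ∀ i ∈ u, HasNablaDerivAt T (f i) (d i) t) (ht : t ∈ T) :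
    HasNablaDerivAt T (fun s => ∑ i ∈ u, f i s) (∑ i ∈ u, d i) t := by
  classical
  induction u using Finset.induction_on with
  | empty => simpa using hasNablaDerivAt_const T 0 t
  | insert i u hi ih =>
    simp only [Finset.sum_insert hi]
    exact (h i (Finset.mem_insert_self i u)).add
      (ih fun j hj => h j (Finset.mem_insert_of_mem hj)) ht

variable {a b : ℝ}

theorem HasNablaDerivAt.congr_of_eqOn_kappa (h : HasNablaDerivAt T f d t)
    (hT : IsCompactScale T a b) (ht : t ∈ kappa T) (hρ : rho T t ∈ kappa T)
    (heq : EqOn g f (kappa T)) : HasNablaDerivAt T g d t := by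
  rw [hasNablaDerivAt_iff_eventually] at h ⊢
  intro ε hε
  filter_upwards [h ε hε, hT.kappa_mem_nhdsWithin ht] with s hs hsκ
  rwa [heq hρ, heq hsκ]

theorem HasNablaDerivAt.unique (hT : IsCompactScale T a b) (ht : t ∈ kappa T)
    (h₁ : HasNablaDerivAt T g c t) (h₂ : HasNablaDerivAt T g d t) : c = d := by
  rcases (rho_le T t).eq_or_lt with hρ | hρ
  · exact (hT.uniqueDiffWithinAt ht hρ).eq_deriv _ ((hasNablaDerivAt_iff_of_eq hρ).1 h₁)
      ((hasNablaDerivAt_iff_of_eq hρ).1 h₂)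
  · have e1 := ((hasNablaDerivAt_iff_of_lt ht.1 hρ).1 h₁).2
    have e2 := ((hasNablaDerivAt_iff_of_lt ht.1 hρ).1 h₂).2
    exact mul_right_cancel₀ (sub_ne_zero.2 hρ.ne') (e1.symm.trans e2)

theorem HasNablaDerivAt.nablaDeriv_eq (hT : IsCompactScale T a b) (ht : t ∈ kappa T)
    (h : HasNablaDerivAt T g d t) : nablaDeriv T g t = d := by
  have hex : ∃ d, HasNablaDerivAt T g d t := ⟨d, h⟩
  rw [nablaDeriv, dif_pos hex]
  exact HasNablaDerivAt.unique hT ht hex.choose_spec h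

theorem NablaDifferentiable.hasNablaDerivAt (h : NablaDifferentiable T g) (ht : t ∈ kappa T) :
    HasNablaDerivAt T g (nablaDeriv T g t) t := by
  rw [nablaDeriv, dif_pos (h t ht)]
  exact (h t ht).choose_spec

/-- A nabla differentiable function is continuous, also at a right-scattered minimum,
which is an isolated point. -/
theorem NablaDifferentiable.continuousOn (hT : IsCompactScale T a b)
    (h : NablaDifferentiable T g) : ContinuousOn g T := by
  intro t ht
  by_cases htκ : t ∈ kappa T
  · exact (h.hasNablaDerivAt htκ).continuousWithinAt ht
  · rw [ContinuousWithinAt, (hT.eq_of_not_mem_kappa ht htκ).2]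
    exact tendsto_pure_nhds g t

theorem IsNablaAntideriv.continuousOn (hT : IsCompactScale T a b) (h : IsNablaAntideriv T f g) :
    ContinuousOn f T :=
  NablaDifferentiable.continuousOn hT fun t ht => ⟨g t, h t ht⟩

end Deriv

/-! ### Monotonicity and uniqueness of antiderivatives -/

section Monotone

variable {T : Set ℝ} {a b c d : ℝ} {F G g : ℝ → ℝ}

/-- A function with nonnegative nabla derivative is monotone. Nabla differentiability gives no
more than continuity from the right at a left-scattered point, so the argument has to run from the
right to the left. -/
theorem IsNablaAntideriv.le (hT : IsCompactScale T a b) (hF : IsNablaAntideriv T F g)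
    (hg : ∀ t ∈ kappa T, 0 ≤ g t) (hc : c ∈ T) (hd : d ∈ T) (hcd : c ≤ d) : F c ≤ F d := by
  suffices H : ∀ ε > 0, F c ≤ F d + ε * (d - c) by
    have hlim : Tendsto (fun ε : ℝ => F d + ε * (d - c)) (𝓝[>] 0) (𝓝 (F d + 0 * (d - c))) :=
      (show Continuous fun ε : ℝ => F d + ε * (d - c) by fun_prop).continuousWithinAt
    rw [zero_mul, add_zero] at hlim
    exact ge_of_tendsto hlim (by filter_upwards [self_mem_nhdsWithin] with ε hε using H ε hε)
  intro ε hε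
  have hcont := hF.continuousOn hT
  set S : Set ℝ := {t ∈ T ∩ Icc c d | F t ≤ F d + ε * (d - t)}
  have hclosed : IsClosed S :=
    (hT.isClosed.inter isClosed_Icc).isClosed_le (hcont.mono inter_subset_left) (by fun_prop)
  have hdS : d ∈ S := ⟨⟨hd, hcd, le_rfl⟩, by simp⟩
  have hbdd : BddBelow S := ⟨c, fun t ht => ht.1.2.1⟩
  have hmS : sInf S ∈ S := hclosed.csInf_mem ⟨d, hdS⟩ hbdd
  set m := sInf S
  rcases hmS.1.2.1.eq_or_lt with hcm | hcm
  · rw [hcm]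
    exact hmS.2
  exfalso
  have hmT : m ∈ T := hmS.1.1
  have hmκ : m ∈ kappa T := hT.mem_kappa_of_lt hmT ((hT.isLeast.2 hc).trans_lt hcm)
  have hder := hF m hmκ
  rcases (rho_le T m).eq_or_lt with hρ | hρ
  · obtain ⟨U, hU, hUT⟩ := hder ε hε
    obtain ⟨δ, hδ, hδU⟩ := Metric.mem_nhds_iff.1 hU
    obtain ⟨r, hr, h1, h2⟩ := exists_mem_Ioo_of_rho_eq hρ hc hcm
      (show max c (m - δ) < m from max_lt hcm (by linarith))
    have h3 := (le_max_left _ _).trans_lt h1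
    have h4 := (le_max_right _ _).trans_lt h1
    have hrU : r ∈ U := hδU (by rw [Metric.mem_ball, Real.dist_eq, abs_of_neg] <;> linarith)
    have h5 := hUT r ⟨hrU, hr⟩
    rw [hρ, abs_of_pos (sub_pos.2 h2)] at h5
    have h6 := (abs_le.1 h5).1
    have h7 : 0 ≤ g m * (m - r) := mul_nonneg (hg m hmκ) (by linarith)
    have hrS : r ∈ S := ⟨⟨hr, h3.le, h2.le.trans hmS.1.2.2⟩, by
      have := hmS.2
      linarith⟩
    exact h2.not_ge (csInf_le hbdd hrS)
  · have h1 := ((hasNablaDerivAt_iff_of_lt hmT hρ).1 hder).2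
    have h2 : 0 ≤ g m * (m - rho T m) := mul_nonneg (hg m hmκ) (by linarith)
    have h3 : 0 ≤ ε * (m - rho T m) := mul_nonneg hε.le (by linarith)
    have hrS : rho T m ∈ S := ⟨⟨rho_mem hT.isClosed hmT, le_rho hc hcm,
      hρ.le.trans hmS.1.2.2⟩, by
      have := hmS.2
      linarith⟩
    exact hρ.not_ge (csInf_le hbdd hrS)

theorem IsNablaAntideriv.const_mul (k : ℝ) (hF : IsNablaAntideriv T F g) :
    IsNablaAntideriv T (fun t => k * F t) (fun t => k * g t) :=
  fun t ht => (hF t ht).const_mul k ht.1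

theorem IsNablaAntideriv.add {f : ℝ → ℝ} (hF : IsNablaAntideriv T F f)
    (hG : IsNablaAntideriv T G g) :
    IsNablaAntideriv T (fun t => F t + G t) (fun t => f t + g t) :=
  fun t ht => (hF t ht).add (hG t ht) ht.1

theorem IsNablaAntideriv.eq_of_zero (hT : IsCompactScale T a b)
    (hF : IsNablaAntideriv T F fun _ => 0) (hc : c ∈ T) (hd : d ∈ T) : F c = F d := by
  wlog hcd : c ≤ d generalizing c d
  · exact (this hd hc (le_of_not_ge hcd)).symm
  have h1 := hF.le hT (fun _ _ => le_rfl) hc hd hcd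
  have h2 := (hF.const_mul (-1)).le hT (fun _ _ => by simp) hc hd hcd
  linarith

theorem IsNablaAntideriv.sub_eq_sub (hT : IsCompactScale T a b) (hF : IsNablaAntideriv T F g)
    (hG : IsNablaAntideriv T G g) (hc : c ∈ T) (hd : d ∈ T) : F d - F c = G d - G c := by
  have h := (hF.add (hG.const_mul (-1)))
  simp only [neg_mul, one_mul, add_neg_cancel] at h
  have := h.eq_of_zero hT hc hd
  linarith

/-- The nabla integral can be computed from any antiderivative. -/
theorem IsNablaAntideriv.nablaIntegral_eq (hT : IsCompactScale T a b)
    (hF : IsNablaAntideriv T F g) (hc : c ∈ T) (hd : d ∈ T) :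
    nablaIntegral T g c d = F d - F c := by
  have hex : ∃ F, IsNablaAntideriv T F g := ⟨F, hF⟩
  rw [nablaIntegral, dif_pos hex]
  exact IsNablaAntideriv.sub_eq_sub hT hex.choose_spec hF hc hd

/-- A nonnegative function with vanishing integral is zero on `T_κ`. -/
theorem IsNablaAntideriv.eq_zero_of_nonneg (hT : IsCompactScale T a b)
    (hF : IsNablaAntideriv T F g) (hg : ∀ t ∈ kappa T, 0 ≤ g t) (hab : F a = F b) :
    ∀ t ∈ kappa T, g t = 0 := by
  have hconst : ∀ s ∈ T, F s = F a := fun s hs =>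
    le_antisymm (hab ▸ hF.le hT hg hs hT.right_mem (hT.subset_Icc hs).2)
      (hF.le hT hg hT.left_mem hs (hT.subset_Icc hs).1)
  intro t ht
  refine (hF t ht).unique hT ht fun ε hε => ⟨univ, univ_mem, fun s hs => ?_⟩
  rw [hconst s hs.2, hconst _ (rho_mem hT.isClosed ht.1)]
  simpa using by positivity

end Monotone

/-! ### ld-continuous functions -/

section LdContinuous

variable {T : Set ℝ} {a b : ℝ} {f g : ℝ → ℝ}

theorem LdContinuousOn.comp₂ {D : Set ℝ} (hf : LdContinuousOn T D f) (hg : LdContinuousOn T D g)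
    {φ : ℝ × ℝ → ℝ} (hφ : Continuous φ) : LdContinuousOn T D fun t => φ (f t, g t) := by
  refine fun t ht => ⟨fun hρ => ?_, fun hσ => ?_⟩
  · exact hφ.continuousAt.comp_continuousWithinAt (((hf t ht).1 hρ).prodMk ((hg t ht).1 hρ))
  · obtain ⟨l, hl⟩ := (hf t ht).2 hσ
    obtain ⟨m, hm⟩ := (hg t ht).2 hσ
    exact ⟨φ (l, m), (hφ.tendsto (l, m)).comp (hl.prodMk_nhds hm)⟩

theorem LdContinuousOn.add {D : Set ℝ} (hf : LdContinuousOn T D f) (hg : LdContinuousOn T D g) :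
    LdContinuousOn T D fun t => f t + g t :=
  hf.comp₂ hg (φ := fun p => p.1 + p.2) (by fun_prop)

theorem LdContinuousOn.mul {D : Set ℝ} (hf : LdContinuousOn T D f) (hg : LdContinuousOn T D g) :
    LdContinuousOn T D fun t => f t * g t :=
  hf.comp₂ hg (φ := fun p => p.1 * p.2) (by fun_prop)

theorem LdContinuousOn.const_mul {D : Set ℝ} (c : ℝ) (hf : LdContinuousOn T D f) :
    LdContinuousOn T D fun t => c * f t :=
  hf.comp₂ hf (φ := fun p => c * p.1) (by fun_prop)

theorem ldContinuousOn_const (T D : Set ℝ) (c : ℝ) : LdContinuousOn T D fun _ => c :=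
  fun _ _ => ⟨fun _ => continuousWithinAt_const, fun _ => ⟨c, tendsto_const_nhds⟩⟩

theorem LdContinuousOn.sum {D : Set ℝ} {ι : Type*} {u : Finset ι} {f : ι → ℝ → ℝ}
    (h : ∀ i ∈ u, LdContinuousOn T D (f i)) : LdContinuousOn T D fun t => ∑ i ∈ u, f i t := by
  classical
  induction u using Finset.induction_on with
  | empty => simpa using ldContinuousOn_const T D 0
  | insert i u hi ih =>
    simp only [Finset.sum_insert hi]
    exact (h i (Finset.mem_insert_self i u)).add
      (ih fun j hj => h j (Finset.mem_insert_of_mem hj))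

theorem LdContinuousOn.congr {D : Set ℝ} (hf : LdContinuousOn T D f) (h : EqOn g f D) :
    LdContinuousOn T D g := by
  refine fun t ht => ⟨fun hρ => ((hf t ht).1 hρ).congr h (h ht), fun hσ => ?_⟩
  obtain ⟨l, hl⟩ := (hf t ht).2 hσ
  refine ⟨l, hl.congr' ?_⟩
  filter_upwards [self_mem_nhdsWithin] with s hs using (h hs.1).symm

theorem ldContinuousOn_of_continuousOn (hf : ContinuousOn f T) :
    LdContinuousOn T (kappa T) f :=
  fun t ht => ⟨fun _ => (hf t ht.1).mono (kappa_subset T), fun _ =>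
    ⟨f t, (hf t ht.1).mono (inter_subset_left.trans (kappa_subset T))⟩⟩

theorem ldContinuousOn_comp_rho (hT : IsClosed T) (hf : ContinuousOn f T) :
    LdContinuousOn T (kappa T) fun t => f (rho T t) := by
  refine fun t ht => ⟨fun hρ => ?_, fun _ => ⟨f t, ?_⟩⟩
  · have h1 : Tendsto (rho T) (𝓝[kappa T] t) (𝓝[T] t) :=
      tendsto_nhdsWithin_iff.2 ⟨(tendsto_rho hρ).mono_left (nhdsWithin_mono _ (kappa_subset T)), by
        filter_upwards [self_mem_nhdsWithin] with s hs using rho_mem hT hs.1⟩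
    rw [ContinuousWithinAt, hρ]
    exact (hf t ht.1).tendsto.comp h1
  · have h1 : Tendsto (rho T) (𝓝[kappa T ∩ Ioi t] t) (𝓝[T] t) :=
      tendsto_nhdsWithin_iff.2 ⟨(tendsto_rho_right ht.1).mono_left
        (nhdsWithin_mono _ (inter_subset_inter_left _ (kappa_subset T))), by
        filter_upwards [self_mem_nhdsWithin] with s hs using rho_mem hT hs.1.1⟩
    exact (hf t ht.1).tendsto.comp h1

/-- An ld-continuous function is locally bounded, hence bounded by compactness. -/
theorem LdContinuousOn.exists_bound (hT : IsCompactScale T a b)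
    (hg : LdContinuousOn T (kappa T) g) : ∃ M, ∀ t ∈ kappa T, |g t| ≤ M := by
  refine hT.isCompact_kappa.induction_on (p := fun S => ∃ M, ∀ t ∈ S, |g t| ≤ M) ⟨0, by simp⟩
    (fun s t hst ⟨M, hM⟩ => ⟨M, fun r hr => hM r (hst hr)⟩) ?_ ?_
  · rintro s t ⟨M, hM⟩ ⟨N, hN⟩
    exact ⟨max M N, fun r hr => hr.elim (fun h => (hM r h).trans (le_max_left _ _))
      fun h => (hN r h).trans (le_max_right _ _)⟩
  intro t ht
  have hleft : ∃ M, ∀ᶠ s in 𝓝[kappa T] t, s < t → |g s| ≤ M := by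
    rcases (rho_le T t).eq_or_lt with hρ | hρ
    · refine ⟨|g t| + 1, ?_⟩
      filter_upwards [((hg t ht).1 hρ).abs.eventually_lt continuousWithinAt_const
        (lt_add_one |g t|)] with s hs _ using hs.le
    · refine ⟨0, ?_⟩
      filter_upwards [self_mem_nhdsWithin, mem_nhdsWithin_of_mem_nhds (Ioi_mem_nhds hρ)]
        with s hs hs' hst
      exact absurd (le_rho hs.1 hst) (not_le.2 hs')
  have hright : ∃ M, ∀ᶠ s in 𝓝[kappa T] t, t < s → |g s| ≤ M := by
    rcases (le_sigma T t).eq_or_lt with hσ | hσ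
    · obtain ⟨l, hl⟩ := (hg t ht).2 hσ.symm
      refine ⟨|l| + 1, ?_⟩
      have h1 := hl.abs.eventually_lt_const (lt_add_one |l|)
      rw [inter_comm, nhdsWithin_inter', eventually_inf_principal] at h1
      rw [eventually_nhdsWithin_iff] at h1 ⊢
      filter_upwards [h1] with s hs hsκ hts
      exact (hs hts hsκ).le
    · refine ⟨0, ?_⟩
      filter_upwards [self_mem_nhdsWithin, mem_nhdsWithin_of_mem_nhds (Iio_mem_nhds hσ)]
        with s hs hs' hst
      exact absurd (sigma_le hs.1 hst) (not_le.2 hs')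
  obtain ⟨M, hM⟩ := hleft
  obtain ⟨N, hN⟩ := hright
  refine ⟨_, hM.and hN, max |g t| (max M N), fun s hs => ?_⟩
  rcases lt_trichotomy s t with h | rfl | h
  · exact (hs.1 h).trans ((le_max_left _ _).trans (le_max_right _ _))
  · exact le_max_left _ _
  · exact (hs.2 h).trans ((le_max_right _ _).trans (le_max_right _ _))

/-- The discontinuities of an ld-continuous function are left-scattered, and a subset of the line
has only countably many left-scattered points. -/
theorem LdContinuousOn.measurable_indicator (hT : IsCompactScale T a b)
    (hg : LdContinuousOn T (kappa T) g) : Measurable ((kappa T).indicator g) := by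
  refine measurable_of_restrict_of_restrict_compl hT.isClosed_kappa.measurableSet ?_ ?_
  · refine measurable_of_countable_not_continuousAt ?_
    have hcount : {t ∈ T | 𝓝[T ∩ Iio t] t = ⊥}.Countable := countable_setOfPred_isolated_left_within
    refine (hcount.preimage Subtype.val_injective).mono ?_
    rintro ⟨t, ht⟩ hnc
    refine ⟨ht.1, ?_⟩
    by_contra hne
    apply hnc
    have hρ : rho T t = t := by
      refine le_antisymm (rho_le T t) (le_of_forall_lt fun c hc => ?_)
      have : (𝓝[T ∩ Iio t] t).NeBot := ⟨hne⟩
      obtain ⟨s, hs, hs'⟩ := this.nonempty_of_mem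
        (inter_mem self_mem_nhdsWithin (mem_nhdsWithin_of_mem_nhds (Ioi_mem_nhds hc)))
      exact (mem_Ioi.1 hs').trans_le (le_rho hs.1 hs.2)
    have h1 := continuousWithinAt_iff_continuousAt_domRestrict _ ht |>.1 ((hg t ht).1 hρ)
    refine h1.congr (Eventually.of_forall fun s => ?_)
    simp
  · have h0 : (kappa T)ᶜ.domRestrict ((kappa T).indicator g) = fun _ => 0 :=
      funext fun s => indicator_of_notMem s.2 g
    rw [h0]
    exact measurable_const

end LdContinuous

/-! ### Existence of antiderivatives -/

section Antideriv

open MeasureTheory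

variable {T : Set ℝ} {a b c d : ℝ} {g : ℝ → ℝ}

/-- The first point of `T` at or after `r`; for `r` beyond the maximum `b` of `T` it is `b`, which
makes it monotone on the whole line. For `g` on `T`, the function `g ∘ nextPoint T b` is the
extension of `g` that is constant on every gap `(ρ(t), t]`, and the nabla integral of `g` is the
Lebesgue integral of this extension. -/
noncomputable def nextPoint (T : Set ℝ) (b r : ℝ) : ℝ := sInf (T ∩ Ici (min r b))

namespace IsCompactScale

theorem nextPoint_mem_inter (h : IsCompactScale T a b) (r : ℝ) :
    nextPoint T b r ∈ T ∩ Ici (min r b) :=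
  (h.isClosed.inter isClosed_Ici).csInf_mem ⟨b, h.right_mem, mem_Ici.2 (min_le_right _ _)⟩
    ⟨min r b, fun _ hs => hs.2⟩

theorem monotone_nextPoint (h : IsCompactScale T a b) : Monotone (nextPoint T b) :=
  fun r _ hrs => csInf_le_csInf ⟨min r b, fun _ hs => hs.2⟩
    ⟨b, h.right_mem, mem_Ici.2 (min_le_right _ _)⟩
    (inter_subset_inter_right _ (Ici_subset_Ici.2 (min_le_min_right b hrs)))

theorem nextPoint_le {r t : ℝ} (ht : t ∈ T) (hrt : r ≤ t) : nextPoint T b r ≤ t :=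
  csInf_le ⟨min r b, fun _ hs => hs.2⟩ ⟨ht, (min_le_left _ _).trans hrt⟩

theorem le_nextPoint (h : IsCompactScale T a b) {r : ℝ} (hr : r ≤ b) : r ≤ nextPoint T b r := by
  have := (h.nextPoint_mem_inter r).2
  rwa [min_eq_left hr] at this

theorem nextPoint_mem_kappa (h : IsCompactScale T a b) {r : ℝ} (hr : r ∈ Ioc a b) :
    nextPoint T b r ∈ kappa T :=
  h.mem_kappa_of_lt (h.nextPoint_mem_inter r).1 (hr.1.trans_le (h.le_nextPoint hr.2))

theorem nextPoint_eq (h : IsCompactScale T a b) {r t : ℝ} (ht : t ∈ T) (hr : r ∈ Ioc (rho T t) t) :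
    nextPoint T b r = t := by
  refine le_antisymm (nextPoint_le ht hr.2) (not_lt.1 fun hlt => ?_)
  have h1 := le_rho (h.nextPoint_mem_inter r).1 hlt
  have h2 := h.le_nextPoint (hr.2.trans (h.subset_Icc ht).2)
  linarith [hr.1]

end IsCompactScale

theorem LdContinuousOn.aestronglyMeasurable (hT : IsCompactScale T a b)
    (hg : LdContinuousOn T (kappa T) g) :
    AEStronglyMeasurable (fun r => g (nextPoint T b r)) (volume.restrict (Ioc a b)) := by
  have h := ((hg.measurable_indicator hT).comp hT.monotone_nextPoint.measurable)
  refine (h.aestronglyMeasurable (μ := volume.restrict (Ioc a b))).congr ?_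
  filter_upwards [ae_restrict_mem measurableSet_Ioc] with r hr
  exact indicator_of_mem (hT.nextPoint_mem_kappa hr) g

theorem LdContinuousOn.integrableOn (hT : IsCompactScale T a b)
    (hg : LdContinuousOn T (kappa T) g) :
    IntegrableOn (fun r => g (nextPoint T b r)) (Ioc a b) := by
  obtain ⟨M, hM⟩ := hg.exists_bound hT
  refine IntegrableOn.of_bound measure_Ioc_lt_top (hg.aestronglyMeasurable hT) M ?_
  filter_upwards [ae_restrict_mem measurableSet_Ioc] with r hr
  exact hM _ (hT.nextPoint_mem_kappa hr)

theorem LdContinuousOn.intervalIntegrable (hT : IsCompactScale T a b)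
    (hg : LdContinuousOn T (kappa T) g) (hc : c ∈ T) (hd : d ∈ T) :
    IntervalIntegrable (fun r => g (nextPoint T b r)) volume c d := by
  have h := (intervalIntegrable_iff_integrableOn_Ioc_of_le hT.lt.le).2 (hg.integrableOn hT)
  refine h.mono_set ?_
  rw [uIcc_of_le hT.lt.le]
  exact uIcc_subset_Icc (hT.subset_Icc hc) (hT.subset_Icc hd)

/-- Every ld-continuous function has a nabla antiderivative, namely the Lebesgue integral of its
extension to the line. -/
theorem LdContinuousOn.isNablaAntideriv (hT : IsCompactScale T a b)
    (hg : LdContinuousOn T (kappa T) g) :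
    IsNablaAntideriv T (fun t => ∫ r in a..t, g (nextPoint T b r)) g := by
  intro t ht
  have hii : ∀ {c d}, c ∈ T → d ∈ T →
      IntervalIntegrable (fun r => g (nextPoint T b r)) volume c d :=
    fun hc hd => hg.intervalIntegrable hT hc hd
  have hsub : ∀ {c d}, c ∈ T → d ∈ T → (∫ r in a..d, g (nextPoint T b r)) -
      (∫ r in a..c, g (nextPoint T b r)) = ∫ r in c..d, g (nextPoint T b r) := fun hc hd =>
    intervalIntegral.integral_interval_sub_left (hii hT.left_mem hd) (hii hT.left_mem hc)
  have hmem : ∀ {s r}, s ∈ T → r ∈ uIoc s t → nextPoint T b r ∈ kappa T := by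
    intro s r hs hr
    refine hT.nextPoint_mem_kappa ⟨?_, ?_⟩
    · exact (le_min (hT.subset_Icc hs).1 (hT.subset_Icc ht.1).1).trans_lt hr.1
    · exact hr.2.trans (max_le (hT.subset_Icc hs).2 (hT.subset_Icc ht.1).2)
  refine hasNablaDerivAt_cases ht.1 (fun hρ => ?_) (fun hρ => ⟨?_, ?_⟩)
  · rw [hasDerivWithinAt_iff_isLittleO, Asymptotics.isLittleO_iff]
    intro ε hε
    obtain ⟨δ, hδ, hball⟩ := Metric.continuousWithinAt_iff.1 ((hg t ht).1 hρ) ε hε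
    filter_upwards [self_mem_nhdsWithin, mem_nhdsWithin_of_mem_nhds (Metric.ball_mem_nhds t hδ)]
      with s hs hs'
    have hswap : (∫ r in a..s, g (nextPoint T b r)) - (∫ r in a..t, g (nextPoint T b r)) -
        (s - t) • g t = -∫ r in s..t, (g (nextPoint T b r) - g t) := by
      rw [intervalIntegral.integral_sub (hii hs ht.1) intervalIntegrable_const,
        ← hsub hs ht.1, intervalIntegral.integral_const]
      simp only [smul_eq_mul]
      ring
    rw [hswap, norm_neg, Real.norm_eq_abs (s - t), abs_sub_comm]
    refine intervalIntegral.norm_integral_le_of_norm_le_const fun r hr => ?_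
    rw [Metric.mem_ball, Real.dist_eq] at hs'
    refine (hball (hmem hs hr) ?_).le
    -- the first point of `T` after a point between `s` and `t` still lies between `s` and `t`
    rw [Real.dist_eq]
    refine lt_of_le_of_lt ?_ hs'
    rcases le_total s t with hst | hst
    · rw [uIoc_of_le hst] at hr
      have h1 := IsCompactScale.nextPoint_le (b := b) ht.1 hr.2
      have h2 := hT.le_nextPoint (hr.2.trans (hT.subset_Icc ht.1).2)
      rw [abs_of_nonpos (by linarith), abs_of_nonpos (by linarith)]
      linarith [hr.1]
    · rw [uIoc_of_ge hst] at hr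
      have h1 := IsCompactScale.nextPoint_le (b := b) hs hr.2
      have h2 := hT.le_nextPoint (hr.2.trans (hT.subset_Icc hs).2)
      rw [abs_of_nonneg (by linarith [hr.1]), abs_of_nonneg (by linarith)]
      linarith
  · obtain ⟨M, hM⟩ := hg.exists_bound hT
    rw [ContinuousWithinAt, tendsto_iff_norm_sub_tendsto_zero]
    have hlim : Tendsto (fun s => M * |t - s|) (𝓝[T] t) (𝓝 (M * |t - t|)) :=
      (show Continuous fun s => M * |t - s| by fun_prop).continuousWithinAt
    rw [sub_self, abs_zero, mul_zero] at hlim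
    refine squeeze_zero' (Eventually.of_forall fun _ => norm_nonneg _) ?_ hlim
    filter_upwards [self_mem_nhdsWithin] with s hs
    rw [norm_sub_rev, hsub hs ht.1]
    exact intervalIntegral.norm_integral_le_of_norm_le_const fun r hr => hM _ (hmem hs hr)
  · have hρT := rho_mem hT.isClosed ht.1
    rw [hsub hρT ht.1, intervalIntegral.integral_congr_ae (g := fun _ => g t)
        (Eventually.of_forall ?_),
      intervalIntegral.integral_const, smul_eq_mul, mul_comm]
    intro r hr
    rw [uIoc_of_le hρ.le] at hr
    simp only [hT.nextPoint_eq ht.1 hr]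

theorem LdContinuousOn.nablaIntegral_eq (hT : IsCompactScale T a b)
    (hg : LdContinuousOn T (kappa T) g) :
    nablaIntegral T g a b = ∫ r in a..b, g (nextPoint T b r) := by
  rw [(hg.isNablaAntideriv hT).nablaIntegral_eq hT hT.left_mem hT.right_mem]
  simp

end Antideriv

/-! ### Functions with continuous partial derivatives -/

/-- A function with continuous partial derivatives is Fréchet differentiable: the coordinates are
released one at a time, each step being the two-variable case. -/
theorem HasContinuousPartials.hasFDerivAt {n : ℕ} {H : (Fin n → ℝ) → ℝ}
    (hH : HasContinuousPartials H) (z : Fin n → ℝ) :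
    HasFDerivAt H (∑ i, partialH H i z • ContinuousLinearMap.proj (R := ℝ) (φ := fun _ => ℝ) i)
      z := by
  have hcont : ∀ i, Continuous (partialH H i) := fun i => (hH i).2
  have key : ∀ (S : Finset (Fin n)) (w h : Fin n → ℝ),
      HasFDerivAt (fun h : Fin n → ℝ => H (w + ∑ i ∈ S, h i • Pi.single i 1))
        (∑ i ∈ S, partialH H i (w + ∑ i ∈ S, h i • Pi.single i 1) •
          ContinuousLinearMap.proj (R := ℝ) (φ := fun _ => ℝ) i) h := by
    intro S
    induction S using Finset.induction_on with
    | empty => exact fun w h => by simpa using hasFDerivAt_const (H w) h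
    | insert j S hj ih =>
      intro w h
      let P : (Fin n → ℝ) → ℝ → Fin n → ℝ := fun h r =>
        w + r • Pi.single j 1 + ∑ i ∈ S, h i • Pi.single i 1
      have hP : Continuous fun p : (Fin n → ℝ) × ℝ => P p.1 p.2 := by fun_prop
      let D₁ : (Fin n → ℝ) → ℝ → (Fin n → ℝ) →L[ℝ] ℝ := fun h r =>
        ∑ i ∈ S, partialH H i (P h r) • ContinuousLinearMap.proj (R := ℝ) (φ := fun _ => ℝ) i
      let D₂ : (Fin n → ℝ) → ℝ → ℝ →L[ℝ] ℝ := fun h r =>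
        ContinuousLinearMap.toSpanSingleton ℝ (partialH H j (P h r))
      have hD₁ : ∀ p : (Fin n → ℝ) × ℝ, HasFDerivAt (fun h => H (P h p.2)) (D₁ p.1 p.2) p.1 :=
        fun p => ih (w + p.2 • Pi.single j 1) p.1
      have hD₂ : ∀ p : (Fin n → ℝ) × ℝ, HasFDerivAt (fun r => H (P p.1 r)) (D₂ p.1 p.2) p.2 := by
        intro p
        have h3 := ((hH j).1 (P p.1 p.2)).hasLineDerivAt
        rw [HasLineDerivAt] at h3
        have h4 : HasDerivAt (fun r : ℝ => r - p.2) 1 p.2 := (hasDerivAt_id _).sub_const _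
        have h5 := HasDerivAt.comp p.2 (h := fun r : ℝ => r - p.2)
          (h₂ := fun r : ℝ => H (P p.1 p.2 + r • Pi.single j 1)) (by simpa using h3) h4
        refine HasDerivAt.hasFDerivAt ?_
        rw [mul_one] at h5
        refine h5.congr_of_eventuallyEq (Eventually.of_forall fun r => ?_)
        simp only [Function.comp, sub_smul, P]
        congr 1
        abel
      have hc₁ : Continuous fun p : (Fin n → ℝ) × ℝ => D₁ p.1 p.2 :=
        continuous_finsetSum _ fun i _ => ((hcont i).comp hP).smul continuous_const
      have hc₂ : Continuous fun p : (Fin n → ℝ) × ℝ => D₂ p.1 p.2 :=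
        (ContinuousLinearMap.toSpanSingletonCLE (𝕜 := ℝ) (E := ℝ)).continuous.comp
          ((hcont j).comp hP)
      have h1 : HasFDerivAt (fun p : (Fin n → ℝ) × ℝ => H (P p.1 p.2))
          ((D₁ h (h j)).coprod (D₂ h (h j))) (h, h j) :=
        (hasStrictFDerivAt_uncurry_coprod (𝕜 := ℝ) (u := (h, h j)) (f := fun h r => H (P h r))
          (f₁ := D₁) (f₂ := D₂) (Eventually.of_forall hD₁) (Eventually.of_forall hD₂)
          hc₁.continuousAt hc₂.continuousAt).hasFDerivAt
      have h2 : HasFDerivAt (fun h : Fin n → ℝ => (h, h j))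
          ((ContinuousLinearMap.id ℝ (Fin n → ℝ)).prod
            (ContinuousLinearMap.proj (R := ℝ) (φ := fun _ => ℝ) j)) h :=
        (hasFDerivAt_id h).prodMk (hasFDerivAt_apply j h)
      have h3 := HasFDerivAt.comp (g := fun p : (Fin n → ℝ) × ℝ => H (P p.1 p.2)) h h1 h2
      have hsum : ∀ k : Fin n → ℝ,
          w + ∑ i ∈ insert j S, k i • Pi.single i (1 : ℝ) = P k (k j) := fun k => by
        rw [Finset.sum_insert hj, ← add_assoc]
      simp only [hsum]
      refine h3.congr_fderiv (ContinuousLinearMap.ext fun k => ?_)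
      simp [Finset.sum_insert hj, D₁, D₂, mul_comm, add_comm]
  have hsum : ∀ h : Fin n → ℝ, ∑ i, h i • Pi.single i (1 : ℝ) = h := fun h => by
    ext k
    simp [Finset.sum_apply, Pi.single_apply]
  simpa [hsum] using key Finset.univ 0 z

theorem HasContinuousPartials.hasDerivAt_comp {n : ℕ} {H : (Fin n → ℝ) → ℝ}
    (hH : HasContinuousPartials H) {z : ℝ → Fin n → ℝ} {z' : Fin n → ℝ} {r : ℝ}
    (hz : ∀ i, HasDerivAt (fun ε => z ε i) (z' i) r) :
    HasDerivAt (fun ε => H (z ε)) (∑ i, partialH H i (z r) * z' i) r := by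
  have h := (hH.hasFDerivAt (z r)).comp_hasDerivAt r (hasDerivAt_pi.2 hz)
  refine h.congr_deriv ?_
  simp

section Variation

variable {T : Set ℝ} {a b t : ℝ} {f : ℝ → ℝ → ℝ → ℝ} {x η : ℝ → ℝ}

theorem IsLagrangian.hasDerivAt_line (hf : IsLagrangian T f) (ht : t ∈ T) (y v k l ε : ℝ) :
    HasDerivAt (fun ε => f t (y + ε * k) (v + ε * l))
      (partialY f t (y + ε * k) (v + ε * l) * k + partialV f t (y + ε * k) (v + ε * l) * l) ε := by
  have h := hasStrictFDerivAt_uncurry_coprod (𝕜 := ℝ) (u := (y + ε * k, v + ε * l)) (f := f t)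
    (f₁ := fun y v => ContinuousLinearMap.toSpanSingleton ℝ (partialY f t y v))
    (f₂ := fun y v => ContinuousLinearMap.toSpanSingleton ℝ (partialV f t y v))
    (Eventually.of_forall fun p => (hf.differentiable_y t ht p.1 p.2).hasDerivAt.hasFDerivAt)
    (Eventually.of_forall fun p => (hf.differentiable_v t ht p.1 p.2).hasDerivAt.hasFDerivAt)
    ((ContinuousLinearMap.toSpanSingletonCLE (𝕜 := ℝ) (E := ℝ)).continuous.comp
      (hf.continuous_y t ht)).continuousAt
    ((ContinuousLinearMap.toSpanSingletonCLE (𝕜 := ℝ) (E := ℝ)).continuous.comp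
      (hf.continuous_v t ht)).continuousAt
  have h1 : HasDerivAt (fun ε => y + ε * k) k ε := by
    simpa using ((hasDerivAt_id ε).mul_const k).const_add y
  have h2 : HasDerivAt (fun ε => v + ε * l) l ε := by
    simpa using ((hasDerivAt_id ε).mul_const l).const_add v
  have h3 := HasFDerivAt.comp_hasDerivAt ε h.hasFDerivAt (h1.prodMk h2)
  refine h3.congr_deriv ?_
  simp [Function.HasUncurry.uncurry]
  ring

/-! ### The class `C¹_ld` -/

theorem c1ld_of_isNablaAntideriv {g F : ℝ → ℝ} (hT : IsCompactScale T a b)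
    (hF : IsNablaAntideriv T F g) (hg : LdContinuousOn T (kappa T) g) : C1ld T F :=
  ⟨fun t ht => ⟨g t, hF t ht⟩, hg.congr fun t ht => (hF t ht).nablaDeriv_eq hT ht⟩

theorem C1ld.isNablaAntideriv (hx : C1ld T x) : IsNablaAntideriv T x (nablaDeriv T x) :=
  fun _ ht => hx.1.hasNablaDerivAt ht

theorem C1ld.add_mul (hT : IsCompactScale T a b) (hx : C1ld T x) (hη : C1ld T η) (ε : ℝ) :
    C1ld T fun t => x t + ε * η t :=
  c1ld_of_isNablaAntideriv hT (hx.isNablaAntideriv.add (hη.isNablaAntideriv.const_mul ε))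
    (hx.2.add (hη.2.const_mul ε))

theorem C1ld.nablaDeriv_add_mul (hT : IsCompactScale T a b) (hx : C1ld T x) (hη : C1ld T η)
    (ε : ℝ) (ht : t ∈ kappa T) :
    nablaDeriv T (fun t => x t + ε * η t) t = nablaDeriv T x t + ε * nablaDeriv T η t :=
  ((hx.isNablaAntideriv.add (hη.isNablaAntideriv.const_mul ε)) t ht).nablaDeriv_eq hT ht

theorem C1ld.along_add_mul (hT : IsCompactScale T a b) (hx : C1ld T x) (hη : C1ld T η)
    (g : ℝ → ℝ → ℝ → ℝ) (ε : ℝ) (ht : t ∈ kappa T) :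
    along T g (fun t => x t + ε * η t) t =
      g t (x (rho T t) + ε * η (rho T t)) (nablaDeriv T x t + ε * nablaDeriv T η t) := by
  rw [along, hx.nablaDeriv_add_mul hT hη ε ht]

theorem C1ld.continuousOn (hT : IsCompactScale T a b) (hx : C1ld T x) : ContinuousOn x T :=
  hx.1.continuousOn hT

theorem C1ld.exists_bound (hT : IsCompactScale T a b) (hx : C1ld T x) :
    ∃ M, 0 ≤ M ∧ (∀ t ∈ T, |x (rho T t)| ≤ M) ∧ ∀ t ∈ kappa T, |nablaDeriv T x t| ≤ M := by
  obtain ⟨M, hM⟩ := hT.isCompact.exists_bound_of_continuousOn (hx.continuousOn hT)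
  obtain ⟨N, hN⟩ := hx.2.exists_bound hT
  refine ⟨max M N, (norm_nonneg _).trans ((hM a hT.left_mem).trans (le_max_left _ _)),
    fun t ht => (hM _ (rho_mem hT.isClosed ht)).trans (le_max_left _ _),
    fun t ht => (hN t ht).trans (le_max_right _ _)⟩

theorem C1ld.exists_normOne_le (hT : IsCompactScale T a b) (hη : C1ld T η) :
    ∃ M, ∀ ε : ℝ, normOne T (fun t => ε * η t) ≤ |ε| * M := by
  obtain ⟨M, hM, h1, h2⟩ := hη.exists_bound hT
  refine ⟨M + M, fun ε => ?_⟩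
  rw [mul_add]
  have h0 : 0 ≤ |ε| * M := by positivity
  refine add_le_add (Real.sSup_le ?_ h0) (Real.sSup_le ?_ h0)
  · rintro _ ⟨t, ht, rfl⟩
    simp only [abs_mul]
    exact mul_le_mul_of_nonneg_left (h1 t ht) (abs_nonneg ε)
  · rintro _ ⟨t, ht, rfl⟩
    simp only
    rw [((hη.isNablaAntideriv.const_mul ε) t ht).nablaDeriv_eq hT ht, abs_mul]
    exact mul_le_mul_of_nonneg_left (h2 t ht) (abs_nonneg ε)

/-! ### The first variation -/

/-- The integrand `f_y[x] η^ρ + f_v[x] η^∇` of the first variation. -/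
noncomputable def variationIntegrand (T : Set ℝ) (f : ℝ → ℝ → ℝ → ℝ) (x η : ℝ → ℝ) (t : ℝ) : ℝ :=
  along T (partialY f) x t * η (rho T t) + along T (partialV f) x t * nablaDeriv T η t

theorem IsLagrangian.ldContinuousOn_variationIntegrand (hT : IsCompactScale T a b)
    (hf : IsLagrangian T f) (hx : C1ld T x) (hη : C1ld T η) :
    LdContinuousOn T (kappa T) (variationIntegrand T f x η) :=
  ((hf.ld_y x hx).mul (ldContinuousOn_comp_rho hT.isClosed (hη.continuousOn hT))).add
    ((hf.ld_v x hx).mul hη.2)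

open MeasureTheory in
/-- Differentiation under the nabla integral. The partial derivatives of `f` are merely bounded and
not uniformly continuous in `t`, so this rests on dominated convergence for the Lebesgue integrals
which represent the nabla integrals. -/
theorem IsLagrangian.hasDerivAt_nablaIntegral (hT : IsCompactScale T a b) (hf : IsLagrangian T f)
    (hx : C1ld T x) (hη : C1ld T η) :
    HasDerivAt (fun ε => nablaIntegral T (along T f fun t => x t + ε * η t) a b)
      (nablaIntegral T (variationIntegrand T f x η) a b) 0 := by
  have hV := hf.ldContinuousOn_variationIntegrand hT hx hη
  have hld : ∀ ε, LdContinuousOn T (kappa T) (along T f fun t => x t + ε * η t) := fun ε =>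
    hf.ld _ (hx.add_mul hT hη ε)
  obtain ⟨A, hA, hA1, hA2⟩ := hx.exists_bound hT
  obtain ⟨B, hB, hB1, hB2⟩ := hη.exists_bound hT
  obtain ⟨M, hM⟩ := hf.bounded (A + B)
  have hIoc : uIoc a b = Ioc a b := uIoc_of_le hT.lt.le
  set F' : ℝ → ℝ → ℝ := fun ε t =>
    partialY f t (x (rho T t) + ε * η (rho T t)) (nablaDeriv T x t + ε * nablaDeriv T η t) *
        η (rho T t) +
      partialV f t (x (rho T t) + ε * η (rho T t)) (nablaDeriv T x t + ε * nablaDeriv T η t) *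
        nablaDeriv T η t
  have hF'0 : F' 0 = variationIntegrand T f x η := by
    funext t
    simp [F', variationIntegrand, along]
  have key := (intervalIntegral.hasDerivAt_integral_of_dominated_loc_of_deriv_le
    (μ := volume) (a := a) (b := b) (x₀ := (0 : ℝ)) (s := Metric.ball 0 1)
    (F := fun ε r => along T f (fun t => x t + ε * η t) (nextPoint T b r))
    (F' := fun ε r => F' ε (nextPoint T b r)) (bound := fun _ => M * B + M * B)
    (Metric.ball_mem_nhds 0 one_pos) ?_ ?_ ?_ ?_ intervalIntegrable_const ?_).2
  · rw [hV.nablaIntegral_eq hT, ← hF'0]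
    refine key.congr_of_eventuallyEq (Eventually.of_forall fun ε => ?_)
    exact (hld ε).nablaIntegral_eq hT
  · refine Eventually.of_forall fun ε => ?_
    rw [hIoc]
    exact (hld ε).aestronglyMeasurable hT
  · exact (hld 0).intervalIntegrable hT hT.left_mem hT.right_mem
  · simp only [hF'0, hIoc]
    exact hV.aestronglyMeasurable hT
  · refine Eventually.of_forall fun r hr ε hε => ?_
    have ht := hT.nextPoint_mem_kappa (hIoc ▸ hr)
    set t := nextPoint T b r
    have hε1 : |ε| ≤ 1 := by simpa using (mem_ball_zero_iff.1 hε).le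
    have hle : ∀ {p q : ℝ}, |p| ≤ A → |q| ≤ B → |p + ε * q| ≤ A + B := fun {p q} hp hq =>
      (abs_add_le _ _).trans (add_le_add hp (by
        rw [abs_mul]
        calc |ε| * |q| ≤ 1 * |q| := by gcongr
          _ ≤ B := by rwa [one_mul]))
    obtain ⟨h1, h2⟩ := hM t ht.1 _ _ (hle (hA1 t ht.1) (hB1 t ht.1)) (hle (hA2 t ht) (hB2 t ht))
    have hM0 : 0 ≤ M := (abs_nonneg _).trans h1
    refine (norm_add_le _ _).trans (add_le_add ?_ ?_)
    · rw [norm_mul]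
      exact mul_le_mul h1 (hB1 t ht.1) (norm_nonneg _) hM0
    · rw [norm_mul]
      exact mul_le_mul h2 (hB2 t ht) (norm_nonneg _) hM0
  · refine Eventually.of_forall fun r hr ε _ => ?_
    have ht := hT.nextPoint_mem_kappa (hIoc ▸ hr)
    refine (hf.hasDerivAt_line ht.1 _ _ _ _ ε).congr_of_eventuallyEq
      (Eventually.of_forall fun ε => ?_)
    exact hx.along_add_mul hT hη f ε ht

/-- The first variation vanishes at a weak local extremizer. -/
theorem firstVariation_eq_zero {n : ℕ} {H : (Fin n → ℝ) → ℝ} {f : Fin n → ℝ → ℝ → ℝ → ℝ}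
    {xa xb : Option ℝ} (hT : IsCompactScale T a b) (hH : HasContinuousPartials H)
    (hf : ∀ i, IsLagrangian T (f i))
    (hx : IsWeakLocalMin T a b xa xb (functional T a b H f) x ∨
      IsWeakLocalMax T a b xa xb (functional T a b H f) x)
    (hη : C1ld T η) (hηa : xa = none ∨ η a = 0) (hηb : xb = none ∨ η b = 0) :
    ∑ i, partialH H i (integrals T a b f x) *
      nablaIntegral T (variationIntegrand T (f i) x η) a b = 0 := by
  have hadm : Admissible T a b xa xb x := hx.elim (·.1) (·.1)
  have hz : ∀ ε : ℝ, Admissible T a b xa xb fun t => x t + ε * η t := by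
    refine fun ε => ⟨hadm.1.add_mul hT hη ε, fun c hc => ?_, fun c hc => ?_⟩
    · have h0 : η a = 0 := hηa.resolve_left (by simp [hc])
      simp [h0, hadm.2.1 c hc]
    · have h0 : η b = 0 := hηb.resolve_left (by simp [hc])
      simp [h0, hadm.2.2 c hc]
  have hsmall : ∀ δ > 0, ∀ᶠ ε in 𝓝 (0 : ℝ),
      normOne T (fun t => (x t + ε * η t) - x t) < δ := by
    intro δ hδ
    obtain ⟨M, hM⟩ := hη.exists_normOne_le hT
    have hc : Tendsto (fun ε : ℝ => |ε| * M) (𝓝 0) (𝓝 0) :=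
      (show Continuous fun ε : ℝ => |ε| * M by fun_prop).tendsto' 0 0 (by simp)
    filter_upwards [hc.eventually_lt_const hδ] with ε hε
    simp only [add_sub_cancel_left]
    exact (hM ε).trans_lt hε
  have hder : HasDerivAt (fun ε : ℝ => functional T a b H f fun t => x t + ε * η t)
      (∑ i, partialH H i (integrals T a b f fun t => x t + 0 * η t) *
        nablaIntegral T (variationIntegrand T (f i) x η) a b) 0 :=
    hH.hasDerivAt_comp (z := fun ε => integrals T a b f fun t => x t + ε * η t)
      fun i => (hf i).hasDerivAt_nablaIntegral hT hadm.1 hη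
  simp only [zero_mul, add_zero] at hder
  rcases hx with ⟨-, δ, hδ, hmin⟩ | ⟨-, δ, hδ, hmax⟩
  · refine IsLocalMin.hasDerivAt_eq_zero ?_ hder
    filter_upwards [hsmall δ hδ] with ε hε
    simpa using hmin _ (hz ε) hε
  · refine IsLocalMax.hasDerivAt_eq_zero ?_ hder
    filter_upwards [hsmall δ hδ] with ε hε
    simpa using hmax _ (hz ε) hε

end Variation

/-! ### The du Bois-Reymond argument -/

section DuBoisReymond

variable {T : Set ℝ} {a b : ℝ} {p Q q : ℝ → ℝ}

/-- Integration by parts: `Φ - Q η - c η` is an antiderivative of `(p - Q - c) η^∇` when `Φ` is one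
of `q η^ρ + p η^∇` and `Q` one of `q`. -/
theorem isNablaAntideriv_by_parts {Φ η η' : ℝ → ℝ} (hQ : IsNablaAntideriv T Q q)
    (hη : IsNablaAntideriv T η η')
    (hΦ : IsNablaAntideriv T Φ fun t => q t * η (rho T t) + p t * η' t) (c : ℝ) :
    IsNablaAntideriv T (fun t => Φ t - (Q t + c) * η t) fun t => (p t - Q t - c) * η' t := by
  intro t ht
  have h1 := ((hQ t ht).add (hasNablaDerivAt_const T c t) ht.1).mul (hη t ht) ht.1
  have h2 := (hΦ t ht).add (h1.const_mul (-1) ht.1) ht.1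
  convert h2 using 1
  · funext s
    ring
  · ring

/-- The du Bois-Reymond lemma. The hypothesis `h` says that `∫_a^b (q η^ρ + p η^∇) ∇t = 0` for every
`η ∈ C¹_ld` vanishing at the end-points. -/
theorem exists_eq_add_const (hT : IsCompactScale T a b) (hp : LdContinuousOn T (kappa T) p)
    (hQ : IsNablaAntideriv T Q q)
    (h : ∀ η, C1ld T η → η a = 0 → η b = 0 → ∃ Φ, IsNablaAntideriv T Φ
      (fun t => q t * η (rho T t) + p t * nablaDeriv T η t) ∧ Φ a = Φ b) :
    ∃ c, ∀ t ∈ kappa T, p t = Q t + c := by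
  have hQld : LdContinuousOn T (kappa T) fun t => p t - Q t :=
    hp.comp₂ (ldContinuousOn_of_continuousOn (hQ.continuousOn hT)) (φ := fun s => s.1 - s.2)
      (by fun_prop)
  set P : ℝ → ℝ := fun t => ∫ r in a..t, (p (nextPoint T b r) - Q (nextPoint T b r))
  have hP : IsNablaAntideriv T P fun t => p t - Q t := hQld.isNablaAntideriv hT
  have hPa : P a = 0 := by simp [P]
  -- the test function is the antiderivative of `p - Q - c` which vanishes at `a`; the mean value
  -- `c` of `p - Q` is what makes it vanish at `b`
  set c : ℝ := P b / (b - a)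
  have hη : IsNablaAntideriv T (fun t => P t + (-c * t + c * a)) fun t => p t - Q t - c := by
    intro t ht
    have h1 := ((hasNablaDerivAt_id T t).const_mul (-c) ht.1).add
      (hasNablaDerivAt_const T (c * a) t) ht.1
    convert (hP t ht).add h1 ht.1 using 1
    ring
  have hηld : LdContinuousOn T (kappa T) fun t => p t - Q t - c :=
    hQld.comp₂ hQld (φ := fun s => s.1 - c) (by fun_prop)
  have hηC := c1ld_of_isNablaAntideriv hT hη hηld
  have hηa : P a + (-c * a + c * a) = 0 := by
    rw [hPa]
    ring
  have hηb : P b + (-c * b + c * a) = 0 := by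
    have : c * (b - a) = P b := div_mul_cancel₀ _ (sub_ne_zero.2 hT.lt.ne')
    linarith
  obtain ⟨Φ, hΦ, hΦab⟩ := h _ hηC hηa hηb
  have hparts := isNablaAntideriv_by_parts hQ hηC.isNablaAntideriv hΦ c
  refine ⟨c, fun t ht => ?_⟩
  have hsq : ∀ s ∈ kappa T, nablaDeriv T (fun t => P t + (-c * t + c * a)) s = p s - Q s - c :=
    fun s hs => (hη s hs).nablaDeriv_eq hT hs
  have h0 := hparts.eq_zero_of_nonneg hT
    (fun s hs => by
      rw [hsq s hs]
      exact mul_self_nonneg _)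
    (by simp only [hηa, hηb, hΦab, mul_zero]) t ht
  rw [hsq t ht, mul_self_eq_zero] at h0
  linarith

/-- The boundary terms of the first variation: if `p = Q + c`, then `(Q + c) η` is an antiderivative
of `q η^ρ + p η^∇`. -/
theorem mul_eq_mul_of_eq_add_const {Φ η : ℝ → ℝ} {c : ℝ} (hT : IsCompactScale T a b)
    (hQ : IsNablaAntideriv T Q q) (hη : C1ld T η) (hp : ∀ t ∈ kappa T, p t = Q t + c)
    (hΦ : IsNablaAntideriv T Φ fun t => q t * η (rho T t) + p t * nablaDeriv T η t)
    (hΦab : Φ a = Φ b) : (Q a + c) * η a = (Q b + c) * η b := by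
  have h1 : IsNablaAntideriv T (fun t => (Q t + c) * η t)
      fun t => q t * η (rho T t) + p t * nablaDeriv T η t := by
    intro t ht
    have := ((hQ t ht).add (hasNablaDerivAt_const T c t) ht.1).mul (hη.1.hasNablaDerivAt ht) ht.1
    rwa [add_zero, ← hp t ht] at this
  have := h1.sub_eq_sub hT hΦ hT.left_mem hT.right_mem
  linarith

end DuBoisReymond

end NablaCalculus

theorem theorem1 {n : ℕ} (T : Set ℝ) (hT : IsClosed T) (a b : ℝ) (ha : a ∈ T) (hb : b ∈ T)
    (hab : a < b) (I : Set ℝ) (hI : I = interval T a b)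
    (H : (Fin n → ℝ) → ℝ) (hH : HasContinuousPartials H)
    (f : Fin n → ℝ → ℝ → ℝ → ℝ) (hf : ∀ i, IsLagrangian I (f i))
    (xa xb : Option ℝ) (x : ℝ → ℝ)
    (hx : IsWeakLocalMin I a b xa xb (functional I a b H f) x ∨
      IsWeakLocalMax I a b xa xb (functional I a b H f) x) :
    -- the Euler-Lagrange equation, at all points of `[a,b]_κ` where the nabla derivative of
    -- functions on `[a,b]_κ` is meaningful
    (∀ t ∈ kappa I, rho I t ∈ kappa I →
      HasNablaDerivAt I
        (fun s => ∑ i, partialH H i (integrals I a b f x) * along I (partialV (f i)) x s)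
        (∑ i, partialH H i (integrals I a b f x) * along I (partialY (f i)) x t) t ∧
      ∀ d : Fin n → ℝ, (∀ i, HasNablaDerivAt I (along I (partialV (f i)) x) (d i) t) →
        ∑ i, partialH H i (integrals I a b f x) * (d i - along I (partialY (f i)) x t) = 0) ∧
    -- the natural boundary condition at `a`
    (xa = none →
      ∑ i, partialH H i (integrals I a b f x) *
        (nablaIntegral I (along I (partialY (f i)) x) a (sigma I a)
          - along I (partialV (f i)) x (sigma I a)) = 0) ∧
    -- the natural boundary condition at `b`
    (xb = none →
      ∑ i, partialH H i (integrals I a b f x) * along I (partialV (f i)) x b = 0) := by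
  have hC : IsCompactScale I a b := hI ▸ isCompactScale_interval hT ha hb hab
  have hxC : C1ld I x := hx.elim (·.1.1) (·.1.1)
  set h : Fin n → ℝ := fun i => partialH H i (integrals I a b f x)
  set p : ℝ → ℝ := fun s => ∑ i, h i * along I (partialV (f i)) x s with hpdef
  set q : ℝ → ℝ := fun s => ∑ i, h i * along I (partialY (f i)) x s with hqdef
  have hp : LdContinuousOn I (kappa I) p :=
    LdContinuousOn.sum fun i _ => ((hf i).ld_v x hxC).const_mul (h i)
  have hq : LdContinuousOn I (kappa I) q :=
    LdContinuousOn.sum fun i _ => ((hf i).ld_y x hxC).const_mul (h i)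
  set R : Fin n → ℝ → ℝ := fun i t =>
    ∫ r in a..t, along I (partialY (f i)) x (nextPoint I b r)
  have hR : ∀ i, IsNablaAntideriv I (R i) (along I (partialY (f i)) x) := fun i =>
    ((hf i).ld_y x hxC).isNablaAntideriv hC
  set Q : ℝ → ℝ := fun t => ∑ i, h i * R i t with hQdef
  have hQ : IsNablaAntideriv I Q q := fun t ht =>
    HasNablaDerivAt.sum (fun i _ => (hR i t ht).const_mul (h i) ht.1) ht.1
  have hQa : Q a = 0 := by simp [Q, R]
  -- the first variation as the increment of an antiderivative
  have hvar : ∀ η, C1ld I η → (xa = none ∨ η a = 0) → (xb = none ∨ η b = 0) →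
      ∃ Φ, IsNablaAntideriv I Φ (fun t => q t * η (rho I t) + p t * nablaDeriv I η t) ∧
        Φ a = Φ b := by
    intro η hη hηa hηb
    have hV : ∀ i, IsNablaAntideriv I _ (variationIntegrand I (f i) x η) := fun i =>
      ((hf i).ldContinuousOn_variationIntegrand hC hxC hη).isNablaAntideriv hC
    refine ⟨fun t => ∑ i, h i * ∫ r in a..t, variationIntegrand I (f i) x η (nextPoint I b r),
      fun t ht => ?_, ?_⟩
    · have := HasNablaDerivAt.sum (u := Finset.univ)
        (fun i _ => (hV i t ht).const_mul (h i) ht.1) ht.1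
      convert this using 1
      simp only [hpdef, hqdef, variationIntegrand, Finset.sum_mul, ← Finset.sum_add_distrib]
      exact Finset.sum_congr rfl fun i _ => by ring
    · have h0 := firstVariation_eq_zero hC hH hf hx hη hηa hηb
      simp only [((hf _).ldContinuousOn_variationIntegrand hC hxC hη).nablaIntegral_eq hC] at h0
      simpa using h0.symm
  obtain ⟨c, hc⟩ := exists_eq_add_const hC hp hQ
    fun η hη hηa hηb => hvar η hη (Or.inr hηa) (Or.inr hηb)
  have hlin : ∀ e : ℝ, C1ld I fun t => t - e := by
    intro e
    refine c1ld_of_isNablaAntideriv (g := fun _ => 1) hC (fun t ht => ?_)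
      (ldContinuousOn_const _ _ _)
    simpa [sub_eq_add_neg] using (hasNablaDerivAt_id I t).add (hasNablaDerivAt_const I (-e) t) ht.1
  refine ⟨fun t ht hρ => ?_, fun hxa => ?_, fun hxb => ?_⟩
  · have hEL : HasNablaDerivAt I p (q t) t := by
      refine HasNablaDerivAt.congr_of_eqOn_kappa (f := fun s => Q s + c) ?_ hC ht hρ hc
      simpa using (hQ t ht).add (hasNablaDerivAt_const I c t) ht.1
    refine ⟨hEL, fun d hd => ?_⟩
    have hsum := HasNablaDerivAt.sum (u := Finset.univ)
      (fun i _ => (hd i).const_mul (h i) ht.1) ht.1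
    have := hsum.unique hC ht hEL
    simp only [mul_sub, Finset.sum_sub_distrib]
    exact sub_eq_zero.2 this
  · obtain ⟨Φ, hΦ, hΦab⟩ := hvar _ (hlin b) (Or.inl hxa) (Or.inr (sub_self b))
    have h1 := mul_eq_mul_of_eq_add_const hC hQ (hlin b) hc hΦ hΦab
    simp only [sub_self, mul_zero, mul_eq_zero, sub_ne_zero.2 hab.ne, or_false] at h1
    have h2 := hc _ hC.sigma_left_mem_kappa
    have h3 : ∀ i, nablaIntegral I (along I (partialY (f i)) x) a (sigma I a) =
        R i (sigma I a) := fun i => by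
      rw [(hR i).nablaIntegral_eq hC hC.left_mem (sigma_mem hC.isClosed hC.left_mem)]
      simp [R]
    simp only [h3, mul_sub, Finset.sum_sub_distrib]
    change Q (sigma I a) - p (sigma I a) = 0
    linarith
  · obtain ⟨Φ, hΦ, hΦab⟩ := hvar _ (hlin a) (Or.inr (sub_self a)) (Or.inl hxb)
    have h1 := mul_eq_mul_of_eq_add_const hC hQ (hlin a) hc hΦ hΦab
    simp only [sub_self, mul_zero, eq_comm (a := (0 : ℝ)), mul_eq_zero, sub_ne_zero.2 hab.ne',
      or_false] at h1
    change p b = 0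
    rw [hc b hC.right_mem_kappa, h1]
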